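/- Let $n\ge 1$, let $x_1,\dots,x_n\in\mathbb C$ be pairwise distinct nodes and $\alpha_1,\dots,\alpha_n\in\mathbb C\setminus\{0\}$ amplitudes, with moments $m_k=\sum_{i=1}^n\alpha_i x_i^k$. Let $d_0,\dots,d_{2n-1}$ be complex tolerance coefficients that may depend on $\epsilon>0$ but stay bounded, $d_k=O(1)$ as $\epsilon\to0^+$. Put $\tilde m_k=m_k+\epsilon d_k$ and let $$\bar q_\epsilon(z)=\det\begin{bmatrix}1&z&\cdots&z^n\\ \tilde m_0&\tilde m_1&\cdots&\tilde m_n\\ \vdots\\ \tilde m_{n-1}&\tilde m_n&\cdots&\tilde m_{2n-1}\end{bmatrix},\qquad D=\begin{bmatrix}0&\cdots&0\\ d_0&\cdots&d_n\\ \vdots\\ d_{n-1}&\cdots&d_{2n-1}\end{bmatrix}.$$ Notation. Let $\mathcal Q$ be the set of increasing sequences of length $n$ in $\{1,\dots,n+1\}$; for $\gamma,\beta\in\mathcal Q$ let $[\operatorname{adj}_n(D)]_{\gamma,\beta}=(-1)^{\sum_{i\in\gamma}i+\sum_{i\in\beta}i}\det D[\beta^c|\gamma^c]$, where $D[\beta^c|\gamma^c]$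 is the submatrix of the rows not in $\beta$ and the columns not in $\gamma$. For $\gamma=(i_1,\dots,i_n)$ let $\lambda(\gamma)$ be the partition $(i_n-i_1-(n-1),\dots,i_2-i_1-1,0)$ and $s_{\lambda(\gamma)}$ its Schur polynomial in $n$ variables. For $\beta=(1,j_1,\dots,j_{n-1})$ let $\psi^{(j)}_{\gamma,\beta}=\det\big[x_\omega^{(j_s-2)+(i_1-1)}\big]_{s=1,\dots,n-1;\ \omega\in[n]\setminus\{j\}}$, with $\omega$ in increasing order. Set $$\Psi_j(D)=(-1)^n\sum_{\gamma\in\mathcal Q}\ \sum_{\beta\in\mathcal Q:\,1\in\beta}[\operatorname{adj}_n(D)]_{\gamma,\beta}\;s_{\lambda(\gamma)}(x_1,\dots,x_n)\;\frac{x_j^{\,i_1-1}\,\psi^{(j)}_{\gamma,\beta}}{\prod_{s<t;\ s,t\in[n]\setminus\{j\}}(x_t-x_s)}.$$ Then: 1. For fixed $d_0,\dots,d_{2n-1}$ and each $j$, $\Psi_j(D)$ is a polynomial in $x_1,\dots,x_n$. 2. For all sufficiently small $\epsilon>0$ the roots of $\bar q_\epsilon$, with multiplicity, can be numbered $\tilde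 x_1(\epsilon),\dots,\tilde x_n(\epsilon)$ so that $\tilde x_j(\epsilon)\to x_j$ as $\epsilon\to0^+$ for every $j$; and for every such numbering and every $j$ $$x_j-\tilde x_j=(-1)^{n+1}\frac{\Psi_j(D)}{\alpha_j\prod_{m\ne j}(x_j-x_m)^2}\,\epsilon+O(\epsilon^2),\qquad \epsilon\to0^+.$$ 3. For all $M,T$ there is a constant $C=C(n,M,T)$ such that the following holds. Suppose that $|x_i|=1$ for all $i$ and that $[n]$ is partitioned into clusters such that, for some $0<\delta<1$, $\tau>1$, $\eta>1$ with $\tau\delta<T$, one has $\delta\le|x_i-x_k|\le\tau\delta$ for any two distinct $i,k$ in the same cluster and $T\le|x_i-x_k|\le\eta T$ for $i,k$ in different clusters. Suppose that $|d_k|\le M$ for all $k$ and all small $\epsilon$. If $j$ lies in a cluster with $\ell_j$ elements, then for all sufficiently small $\epsilon>0$ $$|x_j-\tilde x_j|\le C\,|\alpha_j|^{-1}\,\delta^{2-2\ell_j}\,\epsilon .$$ -/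

import Mathlib

open Filter Topology Asymptotics

noncomputable section

namespace Prony

/-- The algebraic moments `m_k = ∑ⱼ αⱼ xⱼᵏ`. -/
def moment {n : ℕ} (x α : Fin n → ℂ) (k : ℕ) : ℂ := ∑ j, α j * x j ^ k

/-- The homogeneous Prony polynomial of the data `m₀, …, m_{2n-1}`: the determinant of the
`(n+1) × (n+1)` matrix whose first row is `1, z, …, zⁿ` and whose next rows are
`m_r, m_{r+1}, …, m_{r+n}`, `r = 0, …, n-1`. Only `m₀, …, m_{2n-1}` enter. -/
def pronyPoly (n : ℕ) (m : ℕ → ℂ) : Polynomial ℂ :=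
  Matrix.det (Matrix.of (Fin.cons (fun c : Fin (n + 1) => Polynomial.X ^ (c : ℕ))
    (fun (r : Fin n) (c : Fin (n + 1)) => Polynomial.C (m ((r : ℕ) + (c : ℕ)))) :
      Fin (n + 1) → Fin (n + 1) → Polynomial ℂ))

/-- The perturbed Prony polynomial, of the data `m_k + ε d_k`. -/
def perturbedPronyPoly {n : ℕ} (x α : Fin n → ℂ) (d : ℕ → ℂ) (ε : ℝ) : Polynomial ℂ :=
  pronyPoly n (fun k => moment x α k + (ε : ℂ) * d k)

/-- `xt ε 0, …, xt ε (n-1)` are, for all small `ε > 0`, exactly the roots (with multiplicity) of the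
perturbed Prony polynomial, numbered so that the `j`-th one tends to the true node `x j`. -/
structure IsRecoveredNodes {n : ℕ} (x α : Fin n → ℂ) (d : ℝ → ℕ → ℂ) (xt : ℝ → Fin n → ℂ) :
    Prop where
  roots_eq : ∀ᶠ ε in 𝓝[>] (0 : ℝ),
    (perturbedPronyPoly x α (d ε) ε).roots = Finset.univ.val.map (xt ε)
  tendsto : ∀ j, Tendsto (fun ε => xt ε j) (𝓝[>] (0 : ℝ)) (𝓝 (x j))

/-- The `(n+1) × (n+1)` perturbation matrix `D`: first row zero, then the Hankel rows
`d_r, …, d_{r+n}`, `r = 0, …, n-1`. -/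
def pertMatrix (n : ℕ) (d : ℕ → ℂ) : Matrix (Fin (n + 1)) (Fin (n + 1)) ℂ :=
  Matrix.of (Fin.cons (fun _ : Fin (n + 1) => (0 : ℂ))
    (fun (r : Fin n) (c : Fin (n + 1)) => d ((r : ℕ) + (c : ℕ))) :
      Fin (n + 1) → Fin (n + 1) → ℂ)

/-- The increasing enumeration of the indices that do not occur in the increasing sequence `γ`.
Increasing sequences of length `r` in an `m`-element index set are the order embeddings
`Fin r ↪o Fin m`. -/
def complSeq {r m : ℕ} (γ : Fin r ↪o Fin m) : Fin (m - r) ↪o Fin m :=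
  (Finset.univ.map γ.toEmbedding)ᶜ.orderEmbOfFin (by
    rw [Finset.card_compl, Finset.card_map, Finset.card_univ, Fintype.card_fin, Fintype.card_fin])

/-- The entry `[adj_r(A)]_{γ,β}` of the `r`-th adjugate: up to the sign
`(-1)^(∑_{i∈γ} i + ∑_{j∈β} j)`, the minor of `A` on the rows outside `β` and the columns
outside `γ`. (The parity of the sum does not depend on whether indices start from `0` or `1`.) -/
def adjEntry {r m : ℕ} (A : Matrix (Fin m) (Fin m) ℂ) (γ β : Fin r ↪o Fin m) : ℂ :=
  (-1) ^ ((∑ i, (γ i : ℕ)) + ∑ i, (β i : ℕ)) * (A.submatrix (complSeq β) (complSeq γ)).det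

/-- The value at `x₁, …, x_m` of the Schur polynomial of the partition `lam 0 ≥ lam 1 ≥ …`, as the
quotient of alternants `det (x_i ^ (lam_r + m - r)) / det (x_i ^ (m - r))`, `r = 1, …, m`
(with `Fin.rev r` equal to `m - r` in one-based indexing). Only used at pairwise distinct
`x_i`, where the denominator does not vanish. -/
def schur {m : ℕ} (lam : Fin m → ℕ) (x : Fin m → ℂ) : ℂ :=
  (Matrix.of fun i r : Fin m => x i ^ (lam r + (r.rev : ℕ))).det /
    (Matrix.of fun i r : Fin m => x i ^ (r.rev : ℕ)).det

/-- The partition attached to `γ = (i_0 < i_1 < … < i_N)`: with `k_s = i_s - i_0`, it is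
`(k_N - N, …, k_1 - 1, 0)`. -/
def partitionOf {N : ℕ} (γ : Fin (N + 1) ↪o Fin (N + 2)) (r : Fin (N + 1)) : ℕ :=
  ((γ r.rev : ℕ) - (γ 0 : ℕ)) - (r.rev : ℕ)

/-- The determinant `ψ` for the nodes other than the `j`-th one: with
`β = (1, j_1, …, j_{n-1})` and `γ = (i_1, …, i_n)` in one-based indexing, its `s`-th row
consists of the powers `x_ω ^ ((j_s - 2) + (i_1 - 1))`, `ω ≠ j`. -/
def psiDet {N : ℕ} (x : Fin (N + 1) → ℂ) (j : Fin (N + 1)) (γ β : Fin (N + 1) ↪o Fin (N + 2)) : ℂ :=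
  (Matrix.of fun s t : Fin N =>
    x (j.succAbove t) ^ (((β s.succ : ℕ) - 1) + (γ 0 : ℕ))).det

/-- The first-order quantity `Ψ_j(D)` for `n = N + 1` nodes. The sums run over the increasing
sequences `γ`, `β` of length `n` in an `(n+1)`-element index set, `β` containing the first index.
The factor `(-1)^n` goes with the Vandermonde factors being written as `x_t - x_s`, `s < t`. -/
def Psi {N : ℕ} (x : Fin (N + 1) → ℂ) (d : ℕ → ℂ) (j : Fin (N + 1)) : ℂ :=
  (-1) ^ (N + 1) *
    ∑ γ : Fin (N + 1) ↪o Fin (N + 2),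
      ∑ β : Fin (N + 1) ↪o Fin (N + 2) with β 0 = 0,
        adjEntry (pertMatrix (N + 1) d) γ β * schur (partitionOf γ) x *
          (x j ^ (γ 0 : ℕ) * psiDet x j γ β /
            ∏ s : Fin N, ∏ t ∈ Finset.Ioi s, (x (j.succAbove t) - x (j.succAbove s)))

/-- Clustered configuration on the unit circle; `c i` is the cluster to which the `i`-th node
belongs. -/
structure IsClustered {n ζ : ℕ} (x : Fin n → ℂ) (c : Fin n → Fin ζ) (δ τ η T : ℝ) : Prop where
  norm_eq : ∀ i, ‖x i‖ = 1
  delta_pos : 0 < δ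
  delta_lt : δ < 1
  one_lt_tau : 1 < τ
  one_lt_eta : 1 < η
  lt_T : τ * δ < T
  within : ∀ i j, i ≠ j → c i = c j → δ ≤ ‖x i - x j‖ ∧ ‖x i - x j‖ ≤ τ * δ
  between : ∀ i j, c i ≠ c j → T ≤ ‖x i - x j‖ ∧ ‖x i - x j‖ ≤ η * T

/-- The number of nodes in the cluster of the `j`-th node. -/
def clusterSize {n ζ : ℕ} (c : Fin n → Fin ζ) (j : Fin n) : ℕ :=
  (Finset.univ.filter fun i => c i = c j).card

end Prony

end

namespace Prony

open Polynomial

/-! Everything rests on the bilinear form H_m(p, q) = ∑ m_{r+c} p_r q_c. For exact moments H_m(p, q)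
= ∑ α_i p(x_i) q(x_i) (`hankelForm_moment`), and for any data the Prony polynomial is annihilated by
every test polynomial (`hankelForm_pronyPoly`). Testing with P_j = ∏_{i ≠ j} (z - x_i) and dividing
by the leading coefficient gives an identity without error term (`prod_mul_sub_eq_neg_hankelForm`):
α_j P_j(x_j) ∏_{t ≠ j} (x_j - x̃_t) (x_j - x̃_j) = -ε H_d(P_j, ∏ (z - x̃_i)). Since x̃ → x, this
first shows x_j - x̃_j = O(ε); substituted back, it gives the first-order term with error O(ε²).

The Schur and ψ factors in Ψ_j are Vandermonde minors with one column deleted, hence signed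
coefficients of ∏ (z - x_i) and P_j. So Ψ_j = (-1)^n H_d(P_j, ∏ (z - x_i)) (`Psi_eq_hankelForm`),
which yields the polynomiality, the expansion and a bound on Ψ_j that does not see the clusters. The
clusters enter only through the lower bound for ∏ |x_j - x_m|. -/

/-- The monic polynomial with roots `y₁, …, yₙ`. -/
noncomputable def nodePoly {R : Type*} [CommRing R] {n : ℕ} (y : Fin n → R) : R[X] :=
  ∏ i, (X - C (y i))

/-- The bilinear form with Hankel matrix `(m_{r+c})`, on polynomials of degree less than `n` and at
most `n`, in terms of their coefficients. -/
noncomputable def hankelForm (n : ℕ) (m : ℕ → ℂ) (p q : ℂ[X]) : ℂ :=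
  ∑ r : Fin n, ∑ c : Fin (n + 1), m (r + c) * p.coeff r * q.coeff c

theorem nodePoly_natDegree {n : ℕ} (y : Fin n → ℂ) : (nodePoly y).natDegree = n := by
  simp [nodePoly, natDegree_prod_of_monic _ _ fun i _ => monic_X_sub_C (y i)]

theorem nodePoly_eval {n : ℕ} (y : Fin n → ℂ) (z : ℂ) :
    (nodePoly y).eval z = ∏ i, (z - y i) := by
  simp [nodePoly, eval_prod]

/-! ### Minors of Vandermonde matrices -/

/-- Adjoin the indeterminate `X` as an extra node and expand the Vandermonde determinant along its
row: the minors are the wanted ones, while the product formula gives a multiple of `nodePoly y`.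
Compare coefficients. -/
theorem det_pow_succAbove {n : ℕ} (y : Fin n → ℂ) (c : Fin (n + 1)) :
    (Matrix.of fun i s : Fin n => y i ^ (c.succAbove s : ℕ)).det =
      (-1) ^ (n + (c : ℕ)) * (nodePoly y).coeff c * (Matrix.vandermonde y).det := by
  have h := Matrix.det_vandermonde (Fin.cons X (fun i => C (y i)) : Fin (n + 1) → ℂ[X])
  rw [Matrix.det_succ_row_zero] at h
  have hminor : ∀ c : Fin (n + 1),
      ((Matrix.vandermonde (Fin.cons X (fun i => C (y i)) : Fin (n + 1) → ℂ[X])).submatrix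
        Fin.succ c.succAbove).det =
        C (Matrix.of fun i s : Fin n => y i ^ (c.succAbove s : ℕ)).det := by
    intro c
    rw [RingHom.map_det]
    congr 1
    ext1 i s
    simp only [Matrix.submatrix_apply, Matrix.vandermonde_apply, Fin.cons_succ,
      RingHom.mapMatrix_apply, Matrix.map_apply, Matrix.of_apply, map_pow]
  have hprod : (∏ i : Fin (n + 1), ∏ k ∈ Finset.Ioi i,
      ((Fin.cons X (fun i => C (y i)) : Fin (n + 1) → ℂ[X]) k -
        (Fin.cons X (fun i => C (y i)) : Fin (n + 1) → ℂ[X]) i)) =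
      C ((-1) ^ n * (Matrix.vandermonde y).det) * nodePoly y := by
    rw [Fin.prod_univ_succ, Matrix.det_vandermonde]
    have h0 : ∏ k ∈ Finset.Ioi (0 : Fin (n + 1)),
        ((Fin.cons X (fun i => C (y i)) : Fin (n + 1) → ℂ[X]) k -
        (Fin.cons X (fun i => C (y i)) : Fin (n + 1) → ℂ[X]) 0) = (-1) ^ n * nodePoly y := by
      rw [Fin.prod_Ioi_zero]
      simp only [Fin.cons_succ, Fin.cons_zero, nodePoly]
      rw [show ((-1 : ℂ[X]) ^ n) = ∏ _i : Fin n, (-1) by simp, ← Finset.prod_mul_distrib]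
      exact Finset.prod_congr rfl fun i _ => by ring
    rw [h0]
    simp only [Fin.prod_Ioi_succ, Fin.cons_succ, map_mul, map_pow, map_neg, map_one, map_prod,
      map_sub]
    ring
  rw [hprod] at h
  simp only [hminor, Matrix.vandermonde_apply, Fin.cons_zero] at h
  have hc := congrArg (fun p : ℂ[X] => p.coeff c) h
  simp only [finsetSum_coeff, coeff_C_mul] at hc
  rw [Finset.sum_eq_single c] at hc
  · rw [show ((-1 : ℂ[X]) ^ (c : ℕ)) = C ((-1) ^ (c : ℕ)) by simp, coeff_mul_C, coeff_C_mul,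
      coeff_X_pow_self] at hc
    have hs : ((-1 : ℂ) ^ (c : ℕ)) * (-1) ^ (c : ℕ) = 1 := by
      rw [← mul_pow]; simp
    rw [pow_add]
    linear_combination ((-1 : ℂ) ^ (c : ℕ)) * hc -
      (Matrix.of fun i s : Fin n => y i ^ (c.succAbove s : ℕ)).det * hs
  · intro b _ hb
    rw [show ((-1 : ℂ[X]) ^ (b : ℕ)) = C ((-1) ^ (b : ℕ)) by simp, coeff_mul_C, coeff_C_mul,
      coeff_X_pow, if_neg (fun e => hb (Fin.ext e.symm))]
    simp
  · simp

/-! ### Increasing sequences missing one index -/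

theorem exists_eq_succAboveOrderEmb {n : ℕ} (γ : Fin n ↪o Fin (n + 1)) :
    ∃ c, γ = Fin.succAboveOrderEmb c := by
  obtain ⟨c, hc⟩ : ∃ c, c ∉ Set.range γ := by
    by_contra! h
    have := Fintype.card_le_of_surjective γ h
    simp at this
  refine ⟨c, ?_⟩
  have hr : Set.range γ = {c}ᶜ := by
    have hcard : (Finset.univ.map γ.toEmbedding) = ({c}ᶜ : Finset (Fin (n + 1))) := by
      apply Finset.eq_of_subset_of_card_le
      · intro a ha
        simp only [Finset.mem_map, Finset.mem_univ, true_and] at ha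
        obtain ⟨b, rfl⟩ := ha
        simp only [Finset.mem_compl, Finset.mem_singleton]
        rintro rfl
        exact hc ⟨b, rfl⟩
      · simp [Finset.card_compl]
    have := congrArg (fun s : Finset (Fin (n + 1)) => (s : Set (Fin (n + 1)))) hcard
    simpa using this
  apply DFunLike.coe_injective
  rw [← StrictMono.range_inj γ.strictMono (Fin.succAboveOrderEmb c).strictMono, hr]
  simp

/-- Increasing sequences of length `n` in `n + 1` indices correspond to the omitted index. -/
noncomputable def omittedIndexEquiv (n : ℕ) : Fin (n + 1) ≃ (Fin n ↪o Fin (n + 1)) :=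
  Equiv.ofBijective Fin.succAboveOrderEmb
    ⟨fun _ _ h => Fin.succAbove_left_injective
        (congrArg (fun f : Fin n ↪o Fin (n + 1) => (f : Fin n → Fin (n + 1))) h),
      fun γ => (exists_eq_succAboveOrderEmb γ).imp fun _ h => h.symm⟩

theorem omittedIndexEquiv_apply (n : ℕ) (c : Fin (n + 1)) :
    omittedIndexEquiv n c = Fin.succAboveOrderEmb c := rfl

theorem complSeq_succAbove {n : ℕ} (c : Fin (n + 1)) (i : Fin (n + 1 - n)) :
    complSeq (Fin.succAboveOrderEmb c) i = c := by
  have h := Finset.orderEmbOfFin_mem (Finset.univ.map (Fin.succAboveOrderEmb c).toEmbedding)ᶜ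
    (k := n + 1 - n) (by
      rw [Finset.card_compl, Finset.card_map, Finset.card_univ, Fintype.card_fin,
        Fintype.card_fin]) i
  by_contra hne
  obtain ⟨t, ht⟩ := Fin.exists_succAbove_eq hne
  rw [Finset.mem_compl] at h
  exact h (Finset.mem_map.2 ⟨t, Finset.mem_univ _, ht⟩)

/-- The complementary minors have size `n + 1 - n`, which equals `1` only propositionally. -/
theorem det_const_of_eq_one {k : ℕ} (hk : k = 1) (A : Matrix (Fin k) (Fin k) ℂ) (a : ℂ)
    (h : ∀ i j, A i j = a) : A.det = a := by
  subst hk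
  simp [h]

theorem adjEntry_succAbove {n : ℕ} (A : Matrix (Fin (n + 1)) (Fin (n + 1)) ℂ)
    (c r : Fin (n + 1)) :
    adjEntry A (Fin.succAboveOrderEmb c) (Fin.succAboveOrderEmb r) =
      (-1) ^ ((c : ℕ) + r) * A r c := by
  rw [adjEntry, det_const_of_eq_one (by omega) _ (A r c) (by simp [complSeq_succAbove])]
  congr 1
  have h : ∀ c : Fin (n + 1), (∑ i : Fin (n + 1), (i : ℕ)) =
      c + ∑ i, (Fin.succAboveOrderEmb c i : ℕ) := fun c => by
    rw [Fin.sum_univ_succAbove _ c]; rfl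
  have h1 := h c
  have h2 := h r
  apply neg_one_pow_congr
  grind

/-! ### The first-order quantity as a value of the Hankel form -/

/-- The exponents in the Schur numerator are `γ s - γ 0` in reversed order. Reversal affects both
alternants by the same sign, and the powers in front restore `γ s`. -/
theorem prod_pow_mul_schur {N : ℕ} (x : Fin (N + 1) → ℂ) (γ : Fin (N + 1) ↪o Fin (N + 2)) :
    (∏ i, x i ^ (γ 0 : ℕ)) * schur (partitionOf γ) x =
      (Matrix.of fun i s : Fin (N + 1) => x i ^ (γ s : ℕ)).det / (Matrix.vandermonde x).det := by
  -- Makes the truncated subtractions in `partitionOf` genuine.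
  have hγ : ∀ s : Fin (N + 1), (γ 0 : ℕ) + s ≤ γ s := by
    intro s
    induction s using Fin.induction with
    | zero => simp
    | succ i ih =>
      have : γ i.castSucc < γ i.succ := γ.strictMono (Fin.castSucc_lt_succ)
      have := Fin.lt_def.1 this
      simp at ih ⊢
      omega
  have hnum : (Matrix.of fun i r : Fin (N + 1) => x i ^ (partitionOf γ r + (r.rev : ℕ))) =
      (Matrix.of fun i s : Fin (N + 1) => x i ^ ((γ s : ℕ) - γ 0)).submatrix id Fin.revPerm := by
    ext i r
    simp only [Matrix.of_apply, Matrix.submatrix_apply, id, Fin.revPerm_apply, partitionOf]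
    congr 1
    have := hγ r.rev
    omega
  have hden : (Matrix.of fun i r : Fin (N + 1) => x i ^ (r.rev : ℕ)) =
      (Matrix.vandermonde x).submatrix id Fin.revPerm := by
    ext i r
    simp [Matrix.vandermonde_apply]
  have hfac : (Matrix.of fun i s : Fin (N + 1) => x i ^ (γ s : ℕ)).det =
      (∏ i, x i ^ (γ 0 : ℕ)) *
        (Matrix.of fun i s : Fin (N + 1) => x i ^ ((γ s : ℕ) - γ 0)).det := by
    rw [← Matrix.det_mul_column]
    congr 1
    ext i s
    simp only [Matrix.of_apply, ← pow_add]
    congr 1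
    have := hγ s
    omega
  have hsign : ((Equiv.Perm.sign (Fin.revPerm : Equiv.Perm (Fin (N + 1))) : ℤ) : ℂ) ≠ 0 := by
    simp
  rw [schur, hnum, hden, Matrix.det_permute', Matrix.det_permute', hfac,
    mul_div_mul_left _ _ hsign, mul_div_assoc]

theorem psiDet_succAbove {N : ℕ} (x : Fin (N + 1) → ℂ) (j : Fin (N + 1))
    (γ : Fin (N + 1) ↪o Fin (N + 2)) (r : Fin (N + 1)) :
    psiDet x j γ (Fin.succAboveOrderEmb r.succ) =
      (∏ t, x (j.succAbove t) ^ (γ 0 : ℕ)) *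
        (Matrix.of fun t s : Fin N => x (j.succAbove t) ^ (r.succAbove s : ℕ)).det := by
  rw [psiDet, ← Matrix.det_mul_column, ← Matrix.det_transpose]
  congr 1
  ext t s
  simp [← pow_add, add_comm]

/-- The powers `x_i ^ γ 0` pulled out of ψ, together with the separate factor for `x j`, form
exactly the product that `prod_pow_mul_schur` needs. Distinct nodes let both Vandermonde
determinants cancel. -/
theorem schur_mul_psiDet {N : ℕ} {x : Fin (N + 1) → ℂ} (hx : Function.Injective x)
    (j : Fin (N + 1)) (c : Fin (N + 2)) (r : Fin (N + 1)) :
    schur (partitionOf (Fin.succAboveOrderEmb c)) x *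
      (x j ^ (Fin.succAboveOrderEmb c 0 : ℕ) *
        psiDet x j (Fin.succAboveOrderEmb c) (Fin.succAboveOrderEmb r.succ) /
          ∏ s : Fin N, ∏ t ∈ Finset.Ioi s, (x (j.succAbove t) - x (j.succAbove s))) =
      (-1) ^ ((c : ℕ) + r + 1) *
        ((nodePoly (x ∘ j.succAbove)).coeff r * (nodePoly x).coeff c) := by
  have hV : (Matrix.vandermonde x).det ≠ 0 := Matrix.det_vandermonde_ne_zero_iff.2 hx
  have hVj : (Matrix.vandermonde (x ∘ j.succAbove)).det ≠ 0 :=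
    Matrix.det_vandermonde_ne_zero_iff.2 (hx.comp Fin.succAbove_right_injective)
  have h1 := prod_pow_mul_schur x (Fin.succAboveOrderEmb c)
  have h2 := det_pow_succAbove x c
  have h3 := det_pow_succAbove (x ∘ j.succAbove) r
  have hden : (∏ s : Fin N, ∏ t ∈ Finset.Ioi s, (x (j.succAbove t) - x (j.succAbove s))) =
      (Matrix.vandermonde (x ∘ j.succAbove)).det := (Matrix.det_vandermonde _).symm
  simp only [Fin.succAboveOrderEmb_apply] at h1 ⊢
  rw [h2, mul_div_cancel_right₀ _ hV, Fin.prod_univ_succAbove _ j] at h1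
  rw [hden, psiDet_succAbove]
  simp only [Function.comp_apply, Fin.succAboveOrderEmb_apply] at h3 ⊢
  rw [h3, ← mul_assoc, mul_div_assoc, mul_div_cancel_right₀ _ hVj]
  have hs : (-1 : ℂ) ^ (N + 1 + (c : ℕ)) * (-1) ^ (N + (r : ℕ)) = (-1) ^ ((c : ℕ) + r + 1) := by
    rw [← pow_add]
    exact neg_one_pow_congr (by grind)
  rw [← hs]
  linear_combination ((-1) ^ (N + (r : ℕ)) * (nodePoly (x ∘ j.succAbove)).coeff r) * h1

theorem Psi_eq_hankelForm {N : ℕ} {x : Fin (N + 1) → ℂ} (hx : Function.Injective x)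
    (d : ℕ → ℂ) (j : Fin (N + 1)) :
    Psi x d j =
      (-1) ^ (N + 1) * hankelForm (N + 1) d (nodePoly (x ∘ j.succAbove)) (nodePoly x) := by
  rw [Psi, hankelForm, ← (omittedIndexEquiv (N + 1)).sum_comp]
  congr 1
  symm
  rw [Finset.sum_comm]
  symm
  refine Finset.sum_congr rfl fun c _ => ?_
  -- The condition `β 0 = 0` says that the omitted index is not `0`, so it is `r.succ`: row `r` of
  -- the Hankel block in `pertMatrix`.
  rw [Finset.sum_filter, ← (omittedIndexEquiv (N + 1)).sum_comp, Fin.sum_univ_succ,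
    if_neg (by simp [omittedIndexEquiv_apply]), zero_add]
  refine Finset.sum_congr rfl fun r _ => ?_
  rw [if_pos (by simp [omittedIndexEquiv_apply])]
  rw [omittedIndexEquiv_apply, omittedIndexEquiv_apply]
  rw [mul_assoc, schur_mul_psiDet hx, adjEntry_succAbove, ← mul_assoc]
  have hD : pertMatrix (N + 1) d r.succ c = d (r + c) := rfl
  have hs : (-1 : ℂ) ^ ((c : ℕ) + (r.succ : Fin (N + 2))) * (-1) ^ ((c : ℕ) + r + 1) = 1 := by
    rw [← pow_add]
    exact Even.neg_one_pow (by rw [Fin.val_succ]; grind)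
  rw [hD]
  linear_combination (d (r + c) * (nodePoly (x ∘ j.succAbove)).coeff r * (nodePoly x).coeff c) * hs

theorem map_nodePoly {R S : Type*} [CommRing R] [CommRing S] (f : R →+* S) {n : ℕ}
    (y : Fin n → R) : (nodePoly y).map f = nodePoly (f ∘ y) := by
  simp [nodePoly, Polynomial.map_prod]

/-- The witness is the same Hankel form with indeterminates as nodes; specialization commutes with
forming `nodePoly`. -/
theorem exists_mvPolynomial_eval_eq_Psi {N : ℕ} (d : ℕ → ℂ) (j : Fin (N + 1)) :
    ∃ P : MvPolynomial (Fin (N + 1)) ℂ,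
      ∀ x : Fin (N + 1) → ℂ, Function.Injective x → Psi x d j = MvPolynomial.eval x P := by
  refine ⟨(-1) ^ (N + 1) * ∑ r : Fin (N + 1), ∑ c : Fin (N + 2), MvPolynomial.C (d (r + c)) *
    (nodePoly (MvPolynomial.X ∘ j.succAbove :
      Fin N → MvPolynomial (Fin (N + 1)) ℂ)).coeff r *
    (nodePoly (MvPolynomial.X : Fin (N + 1) → MvPolynomial (Fin (N + 1)) ℂ)).coeff c,
    fun x hx => ?_⟩
  have h1 : MvPolynomial.eval x ∘ MvPolynomial.X = x := by ext; simp
  have h2 : MvPolynomial.eval x ∘ MvPolynomial.X ∘ j.succAbove = x ∘ j.succAbove := by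
    ext; simp
  rw [Psi_eq_hankelForm hx, hankelForm]
  simp only [map_mul, map_sum, ← Polynomial.coeff_map, map_nodePoly, h1, h2,
    MvPolynomial.eval_C, map_pow, map_neg, map_one]

/-! ### The Prony polynomial -/

theorem hankelForm_add_mul (n : ℕ) (m d : ℕ → ℂ) (ε : ℂ) (p q : ℂ[X]) :
    hankelForm n (fun k => m k + ε * d k) p q = hankelForm n m p q + ε * hankelForm n d p q := by
  simp only [hankelForm, Finset.mul_sum, ← Finset.sum_add_distrib]
  exact Finset.sum_congr rfl fun _ _ => Finset.sum_congr rfl fun _ _ => by ring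

theorem hankelForm_C_mul (n : ℕ) (m : ℕ → ℂ) (a : ℂ) (p q : ℂ[X]) :
    hankelForm n m p (C a * q) = a * hankelForm n m p q := by
  simp only [hankelForm, Finset.mul_sum, coeff_C_mul]
  exact Finset.sum_congr rfl fun _ _ => Finset.sum_congr rfl fun _ _ => by ring

theorem hankelForm_moment {n : ℕ} (x α : Fin n → ℂ) {p q : ℂ[X]} (hp : p.natDegree < n)
    (hq : q.natDegree < n + 1) :
    hankelForm n (moment x α) p q = ∑ i, α i * p.eval (x i) * q.eval (x i) := by
  simp only [eval_eq_sum_range' hp, eval_eq_sum_range' hq, hankelForm, moment,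
    Finset.sum_range, Finset.sum_mul, Finset.mul_sum]
  rw [Finset.sum_comm]
  symm
  rw [Finset.sum_comm]
  refine Finset.sum_congr rfl fun c _ => ?_
  rw [Finset.sum_comm]
  refine Finset.sum_congr rfl fun r _ => Finset.sum_congr rfl fun i _ => ?_
  rw [pow_add]
  ring

theorem pronyPoly_eq_sum (n : ℕ) (m : ℕ → ℂ) :
    pronyPoly n m = ∑ c : Fin (n + 1), C ((-1) ^ (c : ℕ) *
      (Matrix.of fun r s : Fin n => m (r + c.succAbove s)).det) * X ^ (c : ℕ) := by
  rw [pronyPoly, Matrix.det_succ_row_zero]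
  refine Finset.sum_congr rfl fun c _ => ?_
  rw [C_mul, RingHom.map_det]
  have : (Matrix.of (Fin.cons (fun c : Fin (n + 1) => (X : ℂ[X]) ^ (c : ℕ))
      (fun (r : Fin n) (c : Fin (n + 1)) => C (m ((r : ℕ) + (c : ℕ)))) :
      Fin (n + 1) → Fin (n + 1) → ℂ[X])).submatrix Fin.succ c.succAbove =
      C.mapMatrix (Matrix.of fun r s : Fin n => m (r + c.succAbove s)) := by
    ext1 r s
    rfl
  rw [this, Matrix.of_apply, Fin.cons_zero]
  simp only [map_pow, map_neg, map_one]
  ring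

theorem pronyPoly_coeff (n : ℕ) (m : ℕ → ℂ) (c : Fin (n + 1)) :
    (pronyPoly n m).coeff c = (-1) ^ (c : ℕ) *
      (Matrix.of fun r s : Fin n => m (r + c.succAbove s)).det := by
  rw [pronyPoly_eq_sum, finsetSum_coeff, Finset.sum_eq_single c]
  · rw [coeff_C_mul, coeff_X_pow_self, mul_one]
  · intro b _ hb
    rw [coeff_C_mul, coeff_X_pow, if_neg (fun e => hb (Fin.ext e.symm)), mul_zero]
  · simp

theorem pronyPoly_natDegree_le (n : ℕ) (m : ℕ → ℂ) : (pronyPoly n m).natDegree ≤ n := by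
  rw [pronyPoly_eq_sum]
  refine natDegree_sum_le_of_forall_le _ _ fun c _ => (natDegree_C_mul_X_pow_le _ _).trans ?_
  exact Nat.lt_succ_iff.1 c.2

/-- Replacing the row of powers by a copy of the Hankel row `r` gives a determinant with two equal
rows. -/
theorem hankelForm_pronyPoly (n : ℕ) (m : ℕ → ℂ) (p : ℂ[X]) :
    hankelForm n m p (pronyPoly n m) = 0 := by
  refine Finset.sum_eq_zero fun r _ => ?_
  let A : Matrix (Fin (n + 1)) (Fin (n + 1)) ℂ :=
    Matrix.of (Fin.cons (fun c : Fin (n + 1) => m (r + c)) fun (s : Fin n) c => m (s + c))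
  have hA : A.det = 0 := Matrix.det_zero_of_row_eq (Fin.succ_ne_zero r).symm rfl
  rw [Matrix.det_succ_row_zero] at hA
  rw [← mul_zero (p.coeff r), ← hA, Finset.mul_sum]
  refine Finset.sum_congr rfl fun c _ => ?_
  have : A.submatrix Fin.succ c.succAbove =
      Matrix.of fun r s : Fin n => m (r + c.succAbove s) := rfl
  rw [pronyPoly_coeff, this, show A 0 c = m (r + c) from rfl]
  ring

theorem det_hankel_moment {n : ℕ} (x α : Fin n → ℂ) :
    (Matrix.of fun r s : Fin n => moment x α (r + s)).det =
      (∏ i, α i) * (Matrix.vandermonde x).det ^ 2 := by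
  have : (Matrix.of fun r s : Fin n => moment x α (r + s)) =
      (Matrix.vandermonde x).transpose * Matrix.diagonal α * Matrix.vandermonde x := by
    ext r s
    rw [Matrix.mul_apply]
    simp only [Matrix.mul_diagonal, Matrix.transpose_apply, Matrix.vandermonde_apply, Matrix.of_apply, moment, pow_add]
    exact Finset.sum_congr rfl fun _ _ => by ring
  rw [this, Matrix.det_mul, Matrix.det_mul, Matrix.det_transpose, Matrix.det_diagonal]
  ring

/-- Testing the Hankel form of the perturbed moments against the polynomial that vanishes at all
nodes but the `j`-th one isolates the value at `x j`. -/
theorem eval_node_add_hankelForm {N : ℕ} (x α : Fin (N + 1) → ℂ) (d : ℕ → ℂ) (ε : ℂ)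
    (j : Fin (N + 1)) {q : ℂ[X]} (hq : q.natDegree ≤ N + 1) :
    hankelForm (N + 1) (fun k => moment x α k + ε * d k) (nodePoly (x ∘ j.succAbove)) q =
      α j * (∏ t, (x j - x (j.succAbove t))) * q.eval (x j) +
        ε * hankelForm (N + 1) d (nodePoly (x ∘ j.succAbove)) q := by
  rw [hankelForm_add_mul, hankelForm_moment x α (by rw [nodePoly_natDegree]; omega) (by omega),
    Fin.sum_univ_succAbove _ j, nodePoly_eval, Finset.sum_eq_zero, add_zero]
  · rfl
  · intro t _
    rw [nodePoly_eval, Finset.prod_eq_zero (Finset.mem_univ t) (by simp)]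
    ring

/-! ### Asymptotics of polynomials with converging roots -/

/-- Split off one root at a time. The gauge `g` is kept general because the bootstrap needs both `g
= 1` and `g = ε`. -/
theorem nodePoly_coeff_sub_isBigO {l : Filter ℝ} {g : ℝ → ℝ} {n : ℕ} (y : Fin n → ℂ)
    (yt : ℝ → Fin n → ℂ) (hb : ∀ i, (fun ε => yt ε i) =O[l] (fun _ => (1 : ℝ)))
    (h : ∀ i, (fun ε => y i - yt ε i) =O[l] g) (k : ℕ) :
    (fun ε => (nodePoly (yt ε)).coeff k - (nodePoly y).coeff k) =O[l] g := by
  induction n generalizing k with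
  | zero => simpa [nodePoly] using isBigO_zero g l
  | succ n ih =>
    have ih' := ih (y ∘ Fin.succ) (fun ε => yt ε ∘ Fin.succ) (fun i => hb i.succ)
      (fun i => h i.succ)
    have hfac : ∀ z : Fin (n + 1) → ℂ,
        nodePoly z = X * nodePoly (z ∘ Fin.succ) - C (z 0) * nodePoly (z ∘ Fin.succ) := fun z => by
      rw [nodePoly, Fin.prod_univ_succ, sub_mul]; rfl
    have h1 : (fun ε => yt ε 0 * ((nodePoly (yt ε ∘ Fin.succ)).coeff k -
        (nodePoly (y ∘ Fin.succ)).coeff k)) =O[l] g := by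
      simpa using (hb 0).mul (ih' k)
    have h2 : (fun ε => (y 0 - yt ε 0) * (nodePoly (y ∘ Fin.succ)).coeff k) =O[l] g := by
      simpa [mul_comm] using (h 0).const_mul_left ((nodePoly (y ∘ Fin.succ)).coeff k)
    cases k with
    | zero =>
      refine (h2.sub h1).congr_left fun ε => ?_
      rw [hfac (yt ε), hfac y]
      simp only [coeff_sub, mul_coeff_zero, coeff_X_zero, coeff_C_zero]
      ring
    | succ k =>
      refine ((ih' k).add (h2.sub h1)).congr_left fun ε => ?_
      rw [hfac (yt ε), hfac y]
      simp only [coeff_sub, coeff_C_mul, coeff_X_mul]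
      ring

theorem prod_sub_isBigO {l : Filter ℝ} {g : ℝ → ℝ} {n : ℕ} (y : Fin n → ℂ)
    (yt : ℝ → Fin n → ℂ) (hb : ∀ i, (fun ε => yt ε i) =O[l] (fun _ => (1 : ℝ)))
    (h : ∀ i, (fun ε => y i - yt ε i) =O[l] g) (z : ℂ) :
    (fun ε => ∏ i, (z - yt ε i) - ∏ i, (z - y i)) =O[l] g := by
  have h1 : (fun ε => ∑ k ∈ Finset.range (n + 1),
      z ^ k * ((nodePoly (yt ε)).coeff k - (nodePoly y).coeff k)) =O[l] g :=
    IsBigO.fun_sum fun k _ => (nodePoly_coeff_sub_isBigO y yt hb h k).const_mul_left _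
  refine h1.congr_left fun ε => ?_
  rw [← nodePoly_eval, ← nodePoly_eval, eval_eq_sum_range, eval_eq_sum_range, nodePoly_natDegree,
    nodePoly_natDegree, ← Finset.sum_sub_distrib]
  exact Finset.sum_congr rfl fun _ _ => by ring

theorem hankelForm_isBigO {l : Filter ℝ} {g : ℝ → ℝ} {n : ℕ} {d : ℝ → ℕ → ℂ} (p : ℂ[X])
    {q : ℝ → ℂ[X]} (hd : ∀ k < 2 * n, (fun ε => d ε k) =O[l] (fun _ => (1 : ℝ)))
    (hq : ∀ k, (fun ε => (q ε).coeff k) =O[l] g) :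
    (fun ε => hankelForm n (d ε) p (q ε)) =O[l] g := by
  refine IsBigO.fun_sum fun r _ => IsBigO.fun_sum fun c _ => ?_
  have h := ((hd (r + c) (by omega)).mul (hq c)).const_mul_left (p.coeff r)
  refine (h.congr_left fun ε => ?_).congr_right fun ε => one_mul _
  ring

theorem hankelForm_sub (n : ℕ) (m : ℕ → ℂ) (p q q' : ℂ[X]) :
    hankelForm n m p (q - q') = hankelForm n m p q - hankelForm n m p q' := by
  simp only [hankelForm, coeff_sub, mul_sub, Finset.sum_sub_distrib]

/-! ### Expansion of the recovered nodes -/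

theorem eq_leadingCoeff_mul_nodePoly {n : ℕ} {q : ℂ[X]} {y : Fin n → ℂ} (hq : q.natDegree ≤ n)
    (h : q.roots = Finset.univ.val.map y) : q = C q.leadingCoeff * nodePoly y := by
  have hc : q.roots.card = n := by simp [h]
  have hd : q.roots.card = q.natDegree := le_antisymm (card_roots' q) (by omega)
  conv_lhs => rw [← C_leadingCoeff_mul_prod_multiset_X_sub_C hd, h,
    Multiset.map_map]
  rfl

theorem prod_mul_sub_eq_neg_hankelForm {N : ℕ} (x α : Fin (N + 1) → ℂ) (d : ℕ → ℂ) (ε : ℝ)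
    {y : Fin (N + 1) → ℂ}
    (h : (perturbedPronyPoly x α d ε).roots = Finset.univ.val.map y) (j : Fin (N + 1)) :
    α j * (∏ t, (x j - x (j.succAbove t))) * (∏ t, (x j - y (j.succAbove t))) * (x j - y j) =
      -(ε * hankelForm (N + 1) d (nodePoly (x ∘ j.succAbove)) (nodePoly y)) := by
  set q := perturbedPronyPoly x α d ε with hq
  have hdeg : q.natDegree ≤ N + 1 := pronyPoly_natDegree_le _ _
  have hne : q.leadingCoeff ≠ 0 := by
    -- The zero polynomial has an empty root multiset, but `h` supplies `N + 1` roots.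
    intro h0
    rw [leadingCoeff_eq_zero.1 h0, roots_zero] at h
    have := congrArg Multiset.card h
    simp at this
  have h0 := hankelForm_pronyPoly (N + 1) (fun k => moment x α k + (ε : ℂ) * d k)
    (nodePoly (x ∘ j.succAbove))
  change hankelForm (N + 1) _ _ q = 0 at h0
  rw [eq_leadingCoeff_mul_nodePoly hdeg h, hankelForm_C_mul, mul_eq_zero, or_iff_right hne,
    eval_node_add_hankelForm _ _ _ _ _ (nodePoly_natDegree y).le, nodePoly_eval,
    Fin.prod_univ_succAbove _ j] at h0
  linear_combination h0

theorem node_prod_ne_zero {N : ℕ} {x : Fin (N + 1) → ℂ} (hx : Function.Injective x)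
    (j : Fin (N + 1)) : ∏ t, (x j - x (j.succAbove t)) ≠ 0 :=
  Finset.prod_ne_zero_iff.2 fun t _ => sub_ne_zero.2 fun h => Fin.succAbove_ne j t (hx h).symm

theorem prod_erase_eq_prod_succAbove {M : Type*} [CommMonoid M] {N : ℕ} (f : Fin (N + 1) → M)
    (j : Fin (N + 1)) : ∏ m ∈ Finset.univ.erase j, f m = ∏ t, f (j.succAbove t) := by
  rw [Fin.univ_succAbove N j, Finset.erase_cons, Finset.prod_map]
  rfl

theorem IsRecoveredNodes.expansion {N : ℕ} {x α : Fin (N + 1) → ℂ} {d : ℝ → ℕ → ℂ}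
    (hx : Function.Injective x) (hα : ∀ j, α j ≠ 0)
    (hd : ∀ k < 2 * (N + 1), (fun ε => d ε k) =O[𝓝[>] (0 : ℝ)] (fun _ => (1 : ℝ)))
    {xt : ℝ → Fin (N + 1) → ℂ} (hxt : IsRecoveredNodes x α d xt) (j : Fin (N + 1)) :
    (fun ε : ℝ => (x j - xt ε j) -
      (-1) ^ ((N + 1) + 1) *
        (Psi x (d ε) j / (α j * ∏ m ∈ Finset.univ.erase j, (x j - x m) ^ 2)) * (ε : ℂ))
      =O[𝓝[>] (0 : ℝ)] (fun ε : ℝ => ε ^ 2) := by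
  set l : Filter ℝ := 𝓝[>] (0 : ℝ)
  have hb : ∀ i, (fun ε => xt ε i) =O[l] (fun _ => (1 : ℝ)) := fun i => (hxt.tendsto i).isBigO_one ℝ
  have hε : (fun ε : ℝ => (ε : ℂ)) =O[l] (fun ε : ℝ => ε) :=
    IsBigO.of_bound 1 (by simp)
  have hR : ∀ j : Fin (N + 1), Tendsto (fun ε => ∏ t, (x j - xt ε (j.succAbove t))) l
      (𝓝 (∏ t, (x j - x (j.succAbove t)))) := fun j =>
    tendsto_finsetProd _ fun t _ => (hxt.tendsto _).const_sub _
  have hRinv : ∀ j : Fin (N + 1), (fun ε => (∏ t, (x j - xt ε (j.succAbove t)))⁻¹) =O[l]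
      (fun _ => (1 : ℝ)) := fun j => ((hR j).inv₀ (node_prod_ne_zero hx j)).isBigO_one ℝ
  have hRne : ∀ j : Fin (N + 1), ∀ᶠ ε in l, ∏ t, (x j - xt ε (j.succAbove t)) ≠ 0 := fun j =>
    (hR j).eventually_ne (node_prod_ne_zero hx j)
  have hone : ∀ i, (fun ε => x i - xt ε i) =O[l] (fun _ => (1 : ℝ)) := fun i =>
    ((hxt.tendsto i).const_sub _).isBigO_one ℝ
  have hcoeff : ∀ k, (fun ε => (nodePoly (xt ε)).coeff k) =O[l] (fun _ => (1 : ℝ)) := fun k => by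
    have h1 := (nodePoly_coeff_sub_isBigO x xt hb hone k).add
      (isBigO_const_const ((nodePoly x).coeff k) one_ne_zero l)
    simpa using h1
  -- the recovered nodes are accurate to first order
  have hfirst : ∀ j, (fun ε => x j - xt ε j) =O[l] (fun ε : ℝ => ε) := by
    intro j
    have h1 := ((hε.mul (hankelForm_isBigO (nodePoly (x ∘ j.succAbove)) hd hcoeff)).mul
      (hRinv j)).const_mul_left (-(α j * ∏ t, (x j - x (j.succAbove t)))⁻¹)
    refine (h1.congr' ?_ (Eventually.of_forall fun ε => by simp))
    filter_upwards [hxt.roots_eq, hRne j] with ε hroots hne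
    have h2 := prod_mul_sub_eq_neg_hankelForm x α (d ε) ε hroots j
    have h3 := node_prod_ne_zero hx j
    have h4 := hα j
    generalize (∏ t, (x j - x (j.succAbove t))) = P at *
    generalize (∏ t, (x j - xt ε (j.succAbove t))) = R at *
    generalize hankelForm (N + 1) (d ε) _ (nodePoly (xt ε)) = B at *
    field_simp
    linear_combination -h2
  have hB : (fun ε => hankelForm (N + 1) (d ε) (nodePoly (x ∘ j.succAbove))
      (nodePoly (xt ε) - nodePoly x)) =O[l] (fun ε : ℝ => ε) :=
    hankelForm_isBigO _ hd fun k => by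
      simpa using nodePoly_coeff_sub_isBigO x xt hb hfirst k
  have hB0 : (fun ε => hankelForm (N + 1) (d ε) (nodePoly (x ∘ j.succAbove))
      (nodePoly x)) =O[l] (fun _ => (1 : ℝ)) :=
    hankelForm_isBigO _ hd fun k => isBigO_const_const _ one_ne_zero l
  have hRsub := prod_sub_isBigO (x ∘ j.succAbove) (fun ε => xt ε ∘ j.succAbove)
    (fun i => hb _) (fun i => hfirst _) (x j)
  -- With P and R the products of x_j - x_t and x_j - x̃_t over t ≠ j, and B', B the form at the
  -- true and recovered node polynomials, the error is ε (B'(R - P) - P(B - B')) / (α_j P² R). Both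
  -- differences are O(ε).
  have hmain := ((hε.mul (hRinv j)).mul (((hB0.mul hRsub).congr_right fun ε => one_mul _).sub
    (hB.const_mul_left (∏ t, (x j - x (j.succAbove t)))))).const_mul_left
      (α j * (∏ t, (x j - x (j.succAbove t))) ^ 2)⁻¹
  refine hmain.congr' ?_ (Eventually.of_forall fun ε => by simp [sq])
  filter_upwards [hxt.roots_eq, hRne j] with ε hroots hne
  have h2 := prod_mul_sub_eq_neg_hankelForm x α (d ε) ε hroots j
  have h3 := node_prod_ne_zero hx j
  have h4 := hα j
  have hs : (-1 : ℂ) ^ (N + 1 + 1) * (-1) ^ (N + 1) = -1 := by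
    rw [← pow_add]
    exact Odd.neg_one_pow (by grind)
  rw [Psi_eq_hankelForm hx, prod_erase_eq_prod_succAbove, Finset.prod_pow, hankelForm_sub,
    mul_div_assoc,
    ← mul_assoc ((-1 : ℂ) ^ (N + 1 + 1)), hs]
  simp only [Function.comp_apply]
  generalize (∏ t, (x j - x (j.succAbove t))) = P at *
  generalize (∏ t, (x j - xt ε (j.succAbove t))) = R at *
  generalize hankelForm (N + 1) (d ε) _ (nodePoly (xt ε)) = B at *
  generalize hankelForm (N + 1) (d ε) _ (nodePoly x) = B' at *
  have h5 : x j - xt ε j = -(ε * B) / (α j * P * R) := by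
    rw [eq_div_iff (mul_ne_zero (mul_ne_zero h4 h3) hne)]
    linear_combination h2
  rw [h5]
  field_simp
  ring

/-! ### Existence of the recovered nodes -/

theorem perturbedPronyPoly_coeff_tendsto {n : ℕ} (x α : Fin n → ℂ) {d : ℝ → ℕ → ℂ}
    (hd : ∀ k < 2 * n, (fun ε => d ε k) =O[𝓝[>] (0 : ℝ)] (fun _ => (1 : ℝ))) (c : Fin (n + 1)) :
    Tendsto (fun ε => (perturbedPronyPoly x α (d ε) ε).coeff c) (𝓝[>] (0 : ℝ))
      (𝓝 ((pronyPoly n (moment x α)).coeff c)) := by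
  simp only [perturbedPronyPoly, pronyPoly_coeff]
  refine Tendsto.const_mul _ ?_
  have hcont : Continuous fun A : Matrix (Fin n) (Fin n) ℂ => A.det := continuous_id.matrix_det
  refine (hcont.tendsto _).comp (tendsto_pi_nhds.2 fun r => tendsto_pi_nhds.2 fun s => ?_)
  have hk : (r : ℕ) + (c.succAbove s : ℕ) < 2 * n := by omega
  have hε : Tendsto (fun ε : ℝ => ε) (𝓝[>] (0 : ℝ)) (𝓝 0) := nhdsWithin_le_nhds
  have h1 : (fun ε : ℝ => (ε : ℂ) * d ε (r + c.succAbove s)) =O[𝓝[>] (0 : ℝ)]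
      (fun ε : ℝ => ε) := by
    have h2 : (fun ε : ℝ => (ε : ℂ)) =O[𝓝[>] (0 : ℝ)] (fun ε : ℝ => ε) :=
      IsBigO.of_bound 1 (by simp)
    simpa using h2.mul (hd _ hk)
  simpa using (h1.trans_tendsto hε).const_add (moment x α (r + c.succAbove s))

theorem pronyPoly_moment_eval_node {N : ℕ} {x α : Fin (N + 1) → ℂ} (hx : Function.Injective x)
    (hα : ∀ j, α j ≠ 0) (j : Fin (N + 1)) :
    (pronyPoly (N + 1) (moment x α)).eval (x j) = 0 := by
  have h := eval_node_add_hankelForm x α 0 0 j (pronyPoly_natDegree_le (N + 1) (moment x α))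
  simp only [zero_mul, add_zero, hankelForm_pronyPoly] at h
  simpa [hα j, node_prod_ne_zero hx j] using h.symm

theorem pronyPoly_moment_coeff_ne_zero {N : ℕ} {x α : Fin (N + 1) → ℂ}
    (hx : Function.Injective x) (hα : ∀ j, α j ≠ 0) :
    (pronyPoly (N + 1) (moment x α)).coeff (Fin.last (N + 1)) ≠ 0 := by
  rw [pronyPoly_coeff]
  simp only [Fin.succAbove_last, Fin.val_castSucc, det_hankel_moment]
  exact mul_ne_zero (by simp) (mul_ne_zero (Finset.prod_ne_zero_iff.2 fun i _ => hα i)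
    (pow_ne_zero _ (Matrix.det_vandermonde_ne_zero_iff.2 hx)))

theorem exists_roots_eq_map {n : ℕ} {q : ℂ[X]} (hq : q.natDegree = n) :
    ∃ y : Fin n → ℂ, q.roots = Finset.univ.val.map y := by
  have hc : q.roots.toList.length = n := by
    rw [Multiset.length_toList, ← hq]
    exact IsAlgClosed.card_roots_eq_natDegree
  refine ⟨fun i => q.roots.toList.get (i.cast hc.symm), ?_⟩
  subst hc
  conv_lhs => rw [← Multiset.coe_toList q.roots, ← List.ofFn_get q.roots.toList,
    List.ofFn_eq_map]
  rfl

/-- The leading coefficient stays away from `0` and the value at `x j` tends to `0`, so the product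
of the distances from `x j` to the roots tends to `0`, and with it the smallest distance. Choosing
nearest roots is injective for small ε because the nodes are distinct, hence it numbers all roots.
-/
theorem exists_isRecoveredNodes {N : ℕ} {x α : Fin (N + 1) → ℂ} {d : ℝ → ℕ → ℂ}
    (hx : Function.Injective x) (hα : ∀ j, α j ≠ 0)
    (hd : ∀ k < 2 * (N + 1), (fun ε => d ε k) =O[𝓝[>] (0 : ℝ)] (fun _ => (1 : ℝ))) :
    ∃ xt : ℝ → Fin (N + 1) → ℂ, IsRecoveredNodes x α d xt := by
  set q : ℝ → ℂ[X] := fun ε => perturbedPronyPoly x α (d ε) ε with hqdef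
  have hdeg : ∀ ε, (q ε).natDegree ≤ N + 1 := fun ε => pronyPoly_natDegree_le _ _
  have hcoeff := perturbedPronyPoly_coeff_tendsto x α hd
  have hlead := hcoeff (Fin.last _)
  have hlead0 := pronyPoly_moment_coeff_ne_zero hx hα
  have hY : ∀ ε, ∃ y : Fin (N + 1) → ℂ,
      (q ε).coeff (N + 1) ≠ 0 → (q ε).roots = Finset.univ.val.map y := by
    intro ε
    by_cases h : (q ε).coeff (N + 1) = 0
    -- An arbitrary value for those ε at which the degree drops.
    · exact ⟨0, fun h' => absurd h h'⟩
    · obtain ⟨y, hy⟩ := exists_roots_eq_map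
        (le_antisymm (hdeg ε) (le_natDegree_of_ne_zero h))
      exact ⟨y, fun _ => hy⟩
  choose Y hY using hY
  have hroots : ∀ᶠ ε in 𝓝[>] (0 : ℝ), (q ε).roots = Finset.univ.val.map (Y ε) := by
    filter_upwards [hlead.eventually_ne hlead0] with ε hε using hY ε hε
  have hprod : ∀ j, Tendsto (fun ε => ∏ i, ‖x j - Y ε i‖) (𝓝[>] (0 : ℝ)) (𝓝 0) := by
    intro j
    have h1 : Tendsto (fun ε => (q ε).eval (x j)) (𝓝[>] (0 : ℝ)) (𝓝 0) := by
      rw [← pronyPoly_moment_eval_node hx hα j,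
        eval_eq_sum_range' (Nat.lt_succ_of_le (pronyPoly_natDegree_le _ _)), Finset.sum_range]
      simp only [fun ε => eval_eq_sum_range' (Nat.lt_succ_of_le (hdeg ε)) (x j),
        Finset.sum_range]
      exact tendsto_finsetSum _ fun c _ => (hcoeff c).mul_const _
    have h2 := (h1.div hlead hlead0).norm
    rw [zero_div, norm_zero] at h2
    refine h2.congr' ?_
    filter_upwards [hroots, hlead.eventually_ne hlead0] with ε hε hne
    have h3 : (q ε).natDegree = N + 1 := le_antisymm (hdeg ε) (le_natDegree_of_ne_zero hne)
    have h4 : (q ε).leadingCoeff = (q ε).coeff (N + 1) := by rw [leadingCoeff, h3]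
    have h5 : (q ε).eval (x j) = (q ε).coeff (N + 1) * ∏ i, (x j - Y ε i) := by
      conv_lhs => rw [eq_leadingCoeff_mul_nodePoly (hdeg ε) hε, h4]
      rw [eval_mul, eval_C, nodePoly_eval]
    rw [Pi.div_apply, h5]
    change ‖_ / (q ε).coeff (N + 1)‖ = _
    rw [mul_div_cancel_left₀ _ (show (q ε).coeff (N + 1) ≠ 0 from hne), norm_prod]
  have hmin : ∀ ε j, ∃ i, ∀ k, ‖x j - Y ε i‖ ≤ ‖x j - Y ε k‖ := fun ε j =>
    Finite.exists_min fun i => ‖x j - Y ε i‖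
  choose σ hσ using hmin
  have hclose : ∀ j, ∀ ρ > 0, ∀ᶠ ε in 𝓝[>] (0 : ℝ), ‖x j - Y ε (σ ε j)‖ < ρ := by
    intro j ρ hρ
    filter_upwards [(hprod j).eventually_lt_const (pow_pos hρ (N + 1))] with ε hε
    refine lt_of_pow_lt_pow_left₀ (N + 1) hρ.le (lt_of_le_of_lt ?_ hε)
    calc ‖x j - Y ε (σ ε j)‖ ^ (N + 1) = ∏ _i : Fin (N + 1), ‖x j - Y ε (σ ε j)‖ := by simp
      _ ≤ _ := Finset.prod_le_prod (fun _ _ => norm_nonneg _) fun i _ => hσ ε j i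
  have hinj : ∀ᶠ ε in 𝓝[>] (0 : ℝ), Function.Injective (σ ε) := by
    have h1 : ∀ j k, j ≠ k → ∀ᶠ ε in 𝓝[>] (0 : ℝ), σ ε j ≠ σ ε k := by
      intro j k hjk
      have hpos : 0 < ‖x j - x k‖ / 2 := half_pos (norm_pos_iff.2 (sub_ne_zero.2 (hx.ne hjk)))
      filter_upwards [hclose j _ hpos, hclose k _ hpos] with ε hj hk heq
      rw [heq] at hj
      have := norm_sub_le (x j - Y ε (σ ε k)) (x k - Y ε (σ ε k))
      rw [sub_sub_sub_cancel_right] at this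
      linarith
    have h2 : ∀ᶠ ε in 𝓝[>] (0 : ℝ), ∀ j k, j ≠ k → σ ε j ≠ σ ε k :=
      eventually_all.2 fun j => eventually_all.2 fun k => by
        by_cases hjk : j = k
        · simp [hjk]
        · simpa [hjk] using h1 j k hjk
    filter_upwards [h2] with ε hε j k hjk
    by_contra hne
    exact hε j k hne hjk
  refine ⟨fun ε j => Y ε (σ ε j), ⟨?_, fun j => ?_⟩⟩
  · filter_upwards [hroots, hinj] with ε hε hi
    have hbij : Function.Bijective (σ ε) := Finite.injective_iff_bijective.1 hi
    rw [show perturbedPronyPoly x α (d ε) ε = q ε from rfl, hε]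
    have h1 : Finset.univ.val.map (σ ε) = Finset.univ.val :=
      Multiset.map_univ_val_equiv (Equiv.ofBijective _ hbij)
    conv_lhs => rw [← h1, Multiset.map_map]
    rfl
  · rw [Metric.tendsto_nhds]
    intro ρ hρ
    filter_upwards [hclose j ρ hρ] with ε hε
    rwa [dist_comm, dist_eq_norm]

/-! ### Clustered configurations -/

/-- Each factor `X - C (y i)` at most doubles the bound on the coefficients. -/
theorem nodePoly_coeff_norm_le {n : ℕ} {y : Fin n → ℂ} (hy : ∀ i, ‖y i‖ ≤ 1) (k : ℕ) :
    ‖(nodePoly y).coeff k‖ ≤ 2 ^ n := by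
  induction n generalizing k with
  | zero =>
    simp only [nodePoly, Finset.univ_eq_empty, Finset.prod_empty, coeff_one, pow_zero]
    split_ifs <;> simp
  | succ n ih =>
    have ih' := ih (y := y ∘ Fin.succ) fun i => hy i.succ
    have hfac : nodePoly y = X * nodePoly (y ∘ Fin.succ) - C (y 0) * nodePoly (y ∘ Fin.succ) := by
      rw [nodePoly, Fin.prod_univ_succ, sub_mul]; rfl
    have h1 : ‖(X * nodePoly (y ∘ Fin.succ)).coeff k‖ ≤ 2 ^ n := by
      cases k with
      | zero => simp
      | succ k => rw [coeff_X_mul]; exact ih' k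
    have h2 : ‖(C (y 0) * nodePoly (y ∘ Fin.succ)).coeff k‖ ≤ 2 ^ n := by
      rw [coeff_C_mul, norm_mul]
      exact (mul_le_of_le_one_left (norm_nonneg _) (hy 0)).trans (ih' k)
    rw [hfac, coeff_sub]
    refine (norm_sub_le _ _).trans ?_
    rw [pow_succ]
    linarith

theorem Psi_norm_le {N : ℕ} {x : Fin (N + 1) → ℂ} (hx : Function.Injective x)
    (hnorm : ∀ i, ‖x i‖ ≤ 1) {d : ℕ → ℂ} {M : ℝ} (hd : ∀ k < 2 * (N + 1), ‖d k‖ ≤ M)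
    (j : Fin (N + 1)) :
    ‖Psi x d j‖ ≤ (N + 1) * ((N + 2) * (M * 2 ^ N * 2 ^ (N + 1))) := by
  have hM : 0 ≤ M := (norm_nonneg _).trans (hd 0 (by omega))
  rw [Psi_eq_hankelForm hx, norm_mul, norm_pow, norm_neg, norm_one, one_pow, one_mul, hankelForm]
  have h : ∀ (r : Fin (N + 1)) (c : Fin (N + 1 + 1)),
      ‖d (r + c) * (nodePoly (x ∘ j.succAbove)).coeff r * (nodePoly x).coeff c‖ ≤
        M * 2 ^ N * 2 ^ (N + 1) := by
    intro r c
    rw [norm_mul, norm_mul]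
    have h1 := hd (r + c) (by omega)
    have h2 := nodePoly_coeff_norm_le (y := x ∘ j.succAbove) (fun i => hnorm _) r
    have h3 := nodePoly_coeff_norm_le hnorm c
    gcongr
  refine (norm_sum_le_of_le _ fun r _ => norm_sum_le_of_le _ fun c _ => h r c).trans (le_of_eq ?_)
  simp only [Finset.sum_const, Finset.card_univ, Fintype.card_fin, nsmul_eq_mul]
  push_cast
  ring

theorem IsClustered.injective {n ζ : ℕ} {x : Fin n → ℂ} {c : Fin n → Fin ζ} {δ τ η T : ℝ}
    (h : IsClustered x c δ τ η T) : Function.Injective x := by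
  intro i k hik
  by_contra hne
  have hT : 0 < T := (mul_pos (one_pos.trans h.one_lt_tau) h.delta_pos).trans h.lt_T
  have hδ := h.delta_pos
  by_cases hc : c i = c k
  · have := (h.within i k hne hc).1
    rw [hik, sub_self, norm_zero] at this
    linarith
  · have := (h.between i k hc).1
    rw [hik, sub_self, norm_zero] at this
    linarith

/-- Using `min 1 T` in all `N` factors, also those inside the cluster, keeps the constant
independent of the cluster size. -/
theorem IsClustered.le_prod {N ζ : ℕ} {x : Fin (N + 1) → ℂ} {c : Fin (N + 1) → Fin ζ}
    {δ τ η T : ℝ} (h : IsClustered x c δ τ η T) (j : Fin (N + 1)) :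
    δ ^ (clusterSize c j - 1) * min 1 T ^ N ≤ ∏ m ∈ Finset.univ.erase j, ‖x j - x m‖ := by
  have hδ := h.delta_pos
  have hT : 0 < T := (mul_pos (one_pos.trans h.one_lt_tau) h.delta_pos).trans h.lt_T
  have ht : 0 < min 1 T := lt_min one_pos hT
  have hcard : ((Finset.univ.erase j).filter fun m => c m = c j).card = clusterSize c j - 1 := by
    rw [Finset.filter_erase, Finset.card_erase_of_mem (by simp)]
    rfl
  calc δ ^ (clusterSize c j - 1) * min 1 T ^ N
      = ∏ m ∈ Finset.univ.erase j, (if c m = c j then δ else 1) * min 1 T := by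
        rw [Finset.prod_mul_distrib, Finset.prod_ite, Finset.prod_const, Finset.prod_const_one,
          mul_one, hcard, Finset.prod_const, Finset.card_erase_of_mem (Finset.mem_univ j)]
        simp
    _ ≤ _ := by
        refine Finset.prod_le_prod (fun m _ => ?_) fun m hm => ?_
        · split_ifs <;> positivity
        · split_ifs with hc
          · exact (mul_le_of_le_one_right hδ.le (min_le_left _ _)).trans
              (h.within j m (Finset.ne_of_mem_erase hm).symm hc.symm).1
          · rw [one_mul]
            exact (min_le_right _ _).trans (h.between j m (Ne.symm hc)).1

/-- The first summand of the constant bounds the linear term; the `+ 1` absorbs the quadratic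
remainder. -/
theorem IsRecoveredNodes.norm_sub_le {N ζ : ℕ} {x α : Fin (N + 1) → ℂ} {d : ℝ → ℕ → ℂ}
    {c : Fin (N + 1) → Fin ζ} {δ τ η T M : ℝ} (hx : IsClustered x c δ τ η T) (hα : ∀ j, α j ≠ 0)
    (hd : ∀ k < 2 * (N + 1), ∀ᶠ ε in 𝓝[>] (0 : ℝ), ‖d ε k‖ ≤ M)
    {xt : ℝ → Fin (N + 1) → ℂ} (hxt : IsRecoveredNodes x α d xt) (j : Fin (N + 1)) :
    ∀ᶠ ε in 𝓝[>] (0 : ℝ),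
      ‖x j - xt ε j‖ ≤
        ((N + 1) * ((N + 2) * (M * 2 ^ N * 2 ^ (N + 1))) * ((min 1 T ^ N) ^ 2)⁻¹ + 1) * ‖α j‖⁻¹ *
          δ ^ (2 - 2 * (clusterSize c j : ℤ)) * ε := by
  have hδ := hx.delta_pos
  have hT : 0 < T := (mul_pos (one_pos.trans hx.one_lt_tau) hx.delta_pos).trans hx.lt_T
  have ht : 0 < min 1 T := lt_min one_pos hT
  have hαj : 0 < ‖α j‖ := norm_pos_iff.2 (hα j)
  have hsize : 1 ≤ clusterSize c j := Finset.card_pos.2 ⟨j, by simp⟩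
  set K : ℝ := (N + 1) * ((N + 2) * (M * 2 ^ N * 2 ^ (N + 1))) with hK
  set D : ℝ := δ ^ (clusterSize c j - 1) with hD
  have hDpos : 0 < D := pow_pos hδ _
  have hzpow : δ ^ (2 - 2 * (clusterSize c j : ℤ)) = (D ^ 2)⁻¹ := by
    rw [hD, ← pow_mul, ← zpow_natCast, ← zpow_neg]
    congr 1
    push_cast [Nat.cast_sub hsize]
    ring
  rw [hzpow]
  have hbig := IsRecoveredNodes.expansion hx.injective hα
    (fun k hk => IsBigO.of_bound M (by simpa using hd k hk)) hxt j
  obtain ⟨B, hBpos, hB⟩ := hbig.exists_pos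
  have hd' : ∀ᶠ ε in 𝓝[>] (0 : ℝ), ∀ k < 2 * (N + 1), ‖d ε k‖ ≤ M :=
    (Set.finite_lt_nat (2 * (N + 1))).eventually_all.2 hd
  -- The remainder constant `B` may depend on the whole configuration; only the threshold for ε
  -- feels this.
  have hεs : ∀ᶠ ε in 𝓝[>] (0 : ℝ), B * ε < ‖α j‖⁻¹ * (D ^ 2)⁻¹ := by
    have : Tendsto (fun ε : ℝ => B * ε) (𝓝[>] (0 : ℝ)) (𝓝 (B * 0)) :=
      Tendsto.const_mul _ nhdsWithin_le_nhds
    rw [mul_zero] at this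
    exact this.eventually_lt_const (by positivity)
  filter_upwards [hB.bound, hd', hεs, self_mem_nhdsWithin] with ε h1 h2 h3 h4
  have hε : 0 < ε := h4
  have hPsi := Psi_norm_le hx.injective (fun i => (hx.norm_eq i).le) h2 j
  have hprod := hx.le_prod j
  have hlin : ‖(-1) ^ ((N + 1) + 1) *
      (Psi x (d ε) j / (α j * ∏ m ∈ Finset.univ.erase j, (x j - x m) ^ 2)) * (ε : ℂ)‖ ≤
      K * ((min 1 T ^ N) ^ 2)⁻¹ * ‖α j‖⁻¹ * (D ^ 2)⁻¹ * ε := by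
    rw [norm_mul, norm_mul, norm_pow, norm_neg, norm_one, one_pow, one_mul, norm_div, norm_mul,
      norm_prod]
    simp only [norm_pow]
    rw [Finset.prod_pow, Complex.norm_real, Real.norm_of_nonneg hε.le]
    have hK0 : 0 ≤ K := (norm_nonneg _).trans hPsi
    calc _ ≤ K / (‖α j‖ * (D * min 1 T ^ N) ^ 2) * ε := by gcongr
      _ = _ := by field_simp
  have htri := norm_add_le (x j - xt ε j - (-1) ^ ((N + 1) + 1) *
      (Psi x (d ε) j / (α j * ∏ m ∈ Finset.univ.erase j, (x j - x m) ^ 2)) * (ε : ℂ))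
      ((-1) ^ ((N + 1) + 1) *
      (Psi x (d ε) j / (α j * ∏ m ∈ Finset.univ.erase j, (x j - x m) ^ 2)) * (ε : ℂ))
  rw [sub_add_cancel] at htri
  have hrem : B * ‖ε ^ 2‖ ≤ ‖α j‖⁻¹ * (D ^ 2)⁻¹ * ε := by
    rw [Real.norm_of_nonneg (sq_nonneg ε), sq ε, ← mul_assoc]
    exact mul_le_mul_of_nonneg_right h3.le hε.le
  calc ‖x j - xt ε j‖ ≤ ‖α j‖⁻¹ * (D ^ 2)⁻¹ * ε +
        K * ((min 1 T ^ N) ^ 2)⁻¹ * ‖α j‖⁻¹ * (D ^ 2)⁻¹ * ε :=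
        htri.trans (add_le_add (h1.trans hrem) hlin)
    _ = _ := by ring

end Prony

theorem lemma4p4 (N : ℕ) :
    -- `Ψ_j(D)` is a polynomial in the nodes
    (∀ (d : ℕ → ℂ) (j : Fin (N + 1)), ∃ P : MvPolynomial (Fin (N + 1)) ℂ,
      ∀ x : Fin (N + 1) → ℂ, Function.Injective x → Prony.Psi x d j = MvPolynomial.eval x P) ∧
    -- the recovered nodes exist and have the first-order expansion
    (∀ (x α : Fin (N + 1) → ℂ) (d : ℝ → ℕ → ℂ), Function.Injective x → (∀ j, α j ≠ 0) →
      (∀ k < 2 * (N + 1), (fun ε => d ε k) =O[𝓝[>] (0 : ℝ)] (fun _ => (1 : ℝ))) →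
      (∃ xt : ℝ → Fin (N + 1) → ℂ, Prony.IsRecoveredNodes x α d xt) ∧
      ∀ xt : ℝ → Fin (N + 1) → ℂ, Prony.IsRecoveredNodes x α d xt → ∀ j,
        (fun ε : ℝ => (x j - xt ε j) -
          (-1) ^ ((N + 1) + 1) *
            (Prony.Psi x (d ε) j / (α j * ∏ m ∈ Finset.univ.erase j, (x j - x m) ^ 2)) * (ε : ℂ))
          =O[𝓝[>] (0 : ℝ)] (fun ε : ℝ => ε ^ 2)) ∧
    -- the infinitesimal node bound for clustered configurations; `C` depends only on the number
    -- of nodes, on the bound `M` for the tolerance coefficients and on `T`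
    (∀ M T : ℝ, ∃ C : ℝ, ∀ (x α : Fin (N + 1) → ℂ) (d : ℝ → ℕ → ℂ) (ζ : ℕ)
      (c : Fin (N + 1) → Fin ζ) (δ τ η : ℝ), Prony.IsClustered x c δ τ η T → (∀ j, α j ≠ 0) →
      (∀ k < 2 * (N + 1), ∀ᶠ ε in 𝓝[>] (0 : ℝ), ‖d ε k‖ ≤ M) →
      ∀ xt : ℝ → Fin (N + 1) → ℂ, Prony.IsRecoveredNodes x α d xt → ∀ j,
        ∀ᶠ ε in 𝓝[>] (0 : ℝ),
          ‖x j - xt ε j‖ ≤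
            C * ‖α j‖⁻¹ * δ ^ (2 - 2 * (Prony.clusterSize c j : ℤ)) * ε) := by
  refine ⟨Prony.exists_mvPolynomial_eval_eq_Psi, fun x α d hx hα hd =>
    ⟨Prony.exists_isRecoveredNodes hx hα hd, fun xt hxt j => hxt.expansion hx hα hd j⟩, ?_⟩
  -- The constant is found by unification with `norm_sub_le`, and involves only `N`, `M` and `T`.
  exact fun M T => ⟨_, fun x α d ζ c δ τ η hx hα hd xt hxt j => hxt.norm_sub_le hx hα hd j⟩
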